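/- All spaces are separable metrizable; a space is called zero-dimensional if it has a basis of clopen sets (so the empty space is zero-dimensional). Let $\mathcal F(X)$ be the set of all closed subsets of $X$ and $\mathcal F_0(X)\subseteq\mathcal F(X)$ the set of those that are zero-dimensional subspaces. Fix any embedding of $X$ into a compact metrizable space $\hat X$ (not necessarily with dense image), let $\mathcal K(\hat X)$ be the space of compact subsets of $\hat X$ (including $\emptyset$) with the Vietoris topology, and give $\mathcal F(X)$ the topology induced by the injection $F\mapsto\overline F^{\hat X}$ into $\mathcal K(\hat X)$, by which $\mathcal F(X)$ is also viewed as a subset of $\mathcal K(\hat X)$ (such a topology on $\mathcal F(X)$ is called admissible). A set $A\subseteq Y$ is $\Pi^1_1$ in $Y$ if $Y\setminus A$ is analytic ($\Sigma^1_1$), i.e. empty or a continuous image of $\mathbb N^{\mathbb N}$; it is $\Pi^1_1$-complete in $Y$ if moreover every $\Pi^1_1$ set $B\subseteq 2^{\mathbb N}$ is of the form $f^{-1}(A)$ for some continuous $f:2^{\mathbb N}\to Y$. (1) Let $X$ be analytic. (a) If $\mathcal F_0(X)$ is $\Sigma^1_1$, then $\mathcal F_0(X)$ is a $G_\delta$ subset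 of $\mathcal F(X)$. (b) If $\mathcal F_0(X)$ is $\Pi^1_1$, then $\mathcal F_0(X)$ is either a $G_\delta$ subset of $\mathcal F(X)$ or $\Pi^1_1$-complete. This holds both when "$\Pi^1_1$" and "$\Pi^1_1$-complete" are understood in the Polish space $\mathcal K(\hat X)$ and when both are understood in $\mathcal F(X)$. (2) If $X$ is Polish and $\mathcal F_0(X)$ is an $F_\sigma$ subset of $\mathcal F(X)$, then $X$ is zero-dimensional, hence $\mathcal F_0(X)=\mathcal F(X)$. -/

import Mathlib

open Set Topology TopologicalSpace MeasureTheory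

namespace ZeroDimHyperspace

universe u v

/-- `FHyp e` is the set `𝓕(X)` of all closed subsets of `X`, viewed as a space with the admissible
topology given by a map `e : X → K` (an embedding of `X` into a compact metrizable space `K`, not
necessarily with dense range): see the topology instance below. -/
def FHyp {X : Type u} {K : Type v} [TopologicalSpace X] [TopologicalSpace K] (_e : X → K) :
    Type u :=
  Closeds X

/-- The map `F ↦ closure of F in K`, by which `𝓕(X)` is identified with a set of compact subsets
of `K`. -/
def FHyp.toCompacts {X : Type u} {K : Type v} [TopologicalSpace X] [TopologicalSpace K]
    [CompactSpace K] (e : X → K) (F : FHyp e) : Compacts K :=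
  ⟨closure (e '' F.carrier), isClosed_closure.isCompact⟩

/-- The admissible topology on `𝓕(X)` defined by `e : X → K`: the topology induced by the Vietoris
topology of the hyperspace of compact subsets of `K` (the empty set included) through
`F ↦ closure of F in K`. -/
instance FHyp.instTopologicalSpace {X : Type u} {K : Type v} [TopologicalSpace X]
    [TopologicalSpace K] [CompactSpace K] (e : X → K) : TopologicalSpace (FHyp e) :=
  TopologicalSpace.induced (FHyp.toCompacts e) inferInstance

/-- `X` is zero-dimensional: it has a basis of clopen sets (small inductive dimension at most `0`).
The empty space is counted as zero-dimensional. -/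
def IsZeroDim (X : Type u) [TopologicalSpace X] : Prop :=
  HasSmallInductiveDimensionLE X 0

/-- `𝓕₀(X)`: the closed subsets of `X` that are zero-dimensional subspaces. -/
def FZero {X : Type u} {K : Type v} [TopologicalSpace X] [TopologicalSpace K] (e : X → K) :
    Set (FHyp e) :=
  {F | IsZeroDim F.carrier}

/-- A space is analytic if it is empty or a continuous image of the Baire space `ℕ → ℕ`.
(This is only used for separable metrizable spaces.) -/
def IsAnalyticSpace (X : Type u) [TopologicalSpace X] : Prop :=
  AnalyticSet (Set.univ : Set X)

/-- A countable union of closed sets. -/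
def IsFSigma {Y : Type u} [TopologicalSpace Y] (A : Set Y) : Prop :=
  ∃ C : ℕ → Set Y, (∀ n, IsClosed (C n)) ∧ A = ⋃ n, C n

/-- `A` is coanalytic (`𝚷¹₁`) in the ambient space `Y`: its complement in `Y` is analytic. -/
def IsCoanalytic {Y : Type u} [TopologicalSpace Y] (A : Set Y) : Prop :=
  AnalyticSet Aᶜ

/-- `A ⊆ Y` is `𝚷¹₁`-hard: every coanalytic subset of the Cantor space is the preimage of `A` under
a continuous map from the Cantor space to `Y`. -/
def IsCoanalyticHard {Y : Type u} [TopologicalSpace Y] (A : Set Y) : Prop :=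
  ∀ B : Set (ℕ → Bool), IsCoanalytic B → ∃ f : (ℕ → Bool) → Y, Continuous f ∧ f ⁻¹' A = B

/-- `A ⊆ Y` is `𝚷¹₁`-complete: coanalytic and `𝚷¹₁`-hard. -/
def IsCoanalyticComplete {Y : Type u} [TopologicalSpace Y] (A : Set Y) : Prop :=
  IsCoanalytic A ∧ IsCoanalyticHard A

end ZeroDimHyperspace

namespace ZeroDimHyperspace

open Filter Metric
open scoped ENNReal

/-! Give `X` the metric pulled back from `K`. Then `e` is an isometry, and the admissible topology
is that of the Hausdorff edistance on `Closeds X`. By the countable sum theorem the zero-dimensional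
closed sets form a `σ`-ideal `I`. Statement (1) then rests on two facts valid for every `σ`-ideal of
closed sets. Both exploit that if `G m ∈ I` converge to `F ∈ I`, then `F ∪ ⋃ m, G m` is closed,
hence again in `I` (`closure_iUnion_subset_of_infEDist_le`).

Analytic case (`IsSigmaIdeal.isGδ_of_analyticSet`): let `I = range f`. If a neighbourhood in `I` is
bounded by values `f y` with `y` dominated by a finite sequence `s`, then near each of its members
it is bounded with one more coordinate dominated; otherwise the union of a sequence of
counterexamples would be a member violating the bound. Point-finite refinements organise these
neighbourhoods into a finitely branching tree at each point. A limit of members that lies in every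
level follows a branch by König's lemma, and compactness of the dominated sequences puts it below
some `f z`.

Coanalytic case (`IsSigmaIdeal.isCoanalyticHard`): failure of `G_δ` gives a Hurewicz scheme of
members of `I`, convergent at each node and leaving `I` along every infinite branch. A tree is sent
to the closure of the union of the members at its nodes, which lies in `I` exactly when the tree is
well founded.

Statement (2) is a fusion argument (`isZeroDim_of_isFSigma`): if the whole space is not
zero-dimensional, finite sets approximating sets outside the ideal are arranged so that their limit
is zero-dimensional but avoids each of the given closed families. -/

/-! ### Zero-dimensional spaces and the countable sum theorem. -/

theorem isZeroDim_iff {Y : Type*} [TopologicalSpace Y] :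
    IsZeroDim Y ↔ ∀ (y : Y) (U : Set Y), y ∈ U → IsOpen U → ∃ C, IsClopen C ∧ y ∈ C ∧ C ⊆ U := by
  refine hasSmallInductiveDimensionLT_one_iff.trans ⟨fun h y U hy hU ↦ ?_, fun h ↦ ?_⟩
  · obtain ⟨C, hC, hyC, hCU⟩ := h.exists_subset_of_mem_open hy hU
    exact ⟨C, hC, hyC, hCU⟩
  · refine isTopologicalBasis_of_isOpen_of_nhds (fun C hC ↦ hC.isOpen) fun y U hy hU ↦ ?_
    obtain ⟨C, hC, hyC, hCU⟩ := h y U hy hU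
    exact ⟨C, hC, hyC, hCU⟩

theorem IsZeroDim.of_isInducing {Y Z : Type*} [TopologicalSpace Y] [TopologicalSpace Z]
    {g : Y → Z} (hg : IsInducing g) (hZ : IsZeroDim Z) : IsZeroDim Y := by
  rw [isZeroDim_iff] at hZ ⊢
  intro y U hy hU
  obtain ⟨V, hV, rfl⟩ := hg.isOpen_iff.1 hU
  obtain ⟨C, hC, hyC, hCV⟩ := hZ (g y) V hy hV
  exact ⟨g ⁻¹' C, hC.preimage hg.continuous, hyC, preimage_mono hCV⟩

/-- In a second countable zero-dimensional space disjoint closed sets are separated by a clopen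
set. -/
theorem IsZeroDim.exists_isClopen {Y : Type*} [TopologicalSpace Y] [SecondCountableTopology Y]
    (hY : IsZeroDim Y) {A B : Set Y} (hA : IsClosed A) (hB : IsClosed B) (hAB : Disjoint A B) :
    ∃ C, IsClopen C ∧ A ⊆ C ∧ Disjoint C B := by
  rw [isZeroDim_iff] at hY
  -- By the Lindelöf property countably many such sets suffice. Once they are made disjoint, any
  -- union of them is clopen, since its complement is the union of the others.
  have key : ∀ y, ∃ C, IsClopen C ∧ y ∈ C ∧ (Disjoint C A ∨ Disjoint C B) := by
    intro y
    by_cases hy : y ∈ A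
    · obtain ⟨C, hC, hyC, hCB⟩ := hY y Bᶜ (disjoint_left.1 hAB hy) hB.isOpen_compl
      exact ⟨C, hC, hyC, .inr (disjoint_left.2 hCB)⟩
    · obtain ⟨C, hC, hyC, hCA⟩ := hY y Aᶜ hy hA.isOpen_compl
      exact ⟨C, hC, hyC, .inl (disjoint_left.2 hCA)⟩
  choose c hc hyc hcAB using key
  obtain ⟨s, hs, hsc⟩ :=
    TopologicalSpace.countable_cover_nhds fun y ↦ (hc y).isOpen.mem_nhds (hyc y)
  rcases s.eq_empty_or_nonempty with rfl | hne
  · simp only [mem_empty_iff_false, iUnion_of_empty, iUnion_empty] at hsc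
    exact ⟨∅, isClopen_empty, (subset_univ A).trans hsc.symm.subset, by simp⟩
  obtain ⟨g, rfl⟩ := hs.exists_eq_range hne
  set d : ℕ → Set Y := fun n ↦ c (g n) with hd
  have hdc : ∀ n, IsClopen (disjointed d n) := fun n ↦
    disjointedRec (p := IsClopen) (fun _ _ h ↦ h.diff (hc _)) (hc _)
  have hcov : ∀ y, ∃ n, y ∈ disjointed d n := by
    intro y
    have : y ∈ ⋃ n, disjointed d n := by
      rw [iUnion_disjointed]; simpa [hd] using hsc.symm.subset (mem_univ y)
    simpa using this
  have huniq : ∀ y m n, y ∈ disjointed d m → y ∈ disjointed d n → m = n := by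
    intro y m n hm hn
    by_contra hmn
    exact disjoint_left.1 (disjoint_disjointed d hmn) hm hn
  refine ⟨⋃ n ∈ {n | Disjoint (d n) B}, disjointed d n, ⟨?_, ?_⟩, ?_, ?_⟩
  · have : (⋃ n ∈ {n | Disjoint (d n) B}, disjointed d n)ᶜ =
        ⋃ n ∈ {n | ¬ Disjoint (d n) B}, disjointed d n := by
      ext y
      simp only [mem_compl_iff, mem_iUnion, mem_ofPred_eq, not_exists]
      constructor
      · intro h
        obtain ⟨n, hn⟩ := hcov y
        exact ⟨n, fun h' ↦ h n h' hn, hn⟩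
      · rintro ⟨n, hn, hy⟩ m hm hy'
        exact hn (huniq y m n hy' hy ▸ hm)
    rw [← isOpen_compl_iff, this]
    exact isOpen_biUnion fun n _ ↦ (hdc n).isOpen
  · exact isOpen_biUnion fun n _ ↦ (hdc n).isOpen
  · intro y hy
    obtain ⟨n, hn⟩ := hcov y
    refine mem_biUnion (?_ : Disjoint (d n) B) hn
    exact (hcAB (g n)).resolve_left fun h ↦ disjoint_left.1 h (disjointed_subset d n hn) hy
  · simp only [disjoint_iUnion_left]
    exact fun n hn ↦ Disjoint.mono_left (disjointed_subset d n) hn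

/-- Disjoint closed sets of a normal space are shrinkings of open sets with disjoint closures. -/
theorem exists_isOpen_disjoint_closure {Y : Type*} [TopologicalSpace Y] [NormalSpace Y]
    {A B : Set Y} (hA : IsClosed A) (hB : IsClosed B) (hAB : Disjoint A B) :
    ∃ U V, IsOpen U ∧ IsOpen V ∧ A ⊆ U ∧ B ⊆ V ∧ Disjoint (closure U) (closure V) := by
  obtain ⟨U, hU, hAU, hUB⟩ :=
    normal_exists_closure_subset hA hB.isOpen_compl (disjoint_left.1 hAB)
  obtain ⟨V, hV, hBV, hVU⟩ :=
    normal_exists_closure_subset hB isClosed_closure.isOpen_compl (subset_compl_comm.1 hUB)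
  exact ⟨U, V, hU, hV, hAU, hBV, disjoint_right.2 hVU⟩

/-- A partition between two disjoint closed sets can be extended along a closed zero-dimensional
subspace. -/
theorem IsZeroDim.exists_isOpen_cover {Y : Type*} [TopologicalSpace Y] [NormalSpace Y]
    [SecondCountableTopology Y] {F : Set Y} (hF : IsClosed F) (hF0 : IsZeroDim F)
    {A B : Set Y} (hA : IsClosed A) (hB : IsClosed B) (hAB : Disjoint A B) :
    ∃ U V, IsOpen U ∧ IsOpen V ∧ A ⊆ U ∧ B ⊆ V ∧ Disjoint (closure U) (closure V) ∧
      F ⊆ U ∪ V := by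
  obtain ⟨C, hC, hAC, hCB⟩ := hF0.exists_isClopen (A := (↑) ⁻¹' A) (B := (↑) ⁻¹' B)
    (hA.preimage continuous_subtype_val) (hB.preimage continuous_subtype_val) (hAB.preimage _)
  have h1 : IsClosed ((↑) '' C : Set Y) := hF.isClosedEmbedding_subtypeVal.isClosedMap _ hC.isClosed
  have h2 : IsClosed ((↑) '' Cᶜ : Set Y) :=
    hF.isClosedEmbedding_subtypeVal.isClosedMap _ hC.compl.isClosed
  obtain ⟨U, V, hU, hV, hAU, hBV, hUV⟩ := exists_isOpen_disjoint_closure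
    (hA.union h1) (hB.union h2) (by
      rw [disjoint_union_left, disjoint_union_right, disjoint_union_right]
      refine ⟨⟨hAB, ?_⟩, ?_, ?_⟩
      · rw [disjoint_right]
        rintro _ ⟨y, hy, rfl⟩ hyA
        exact hy (hAC hyA)
      · rw [disjoint_left]
        rintro _ ⟨y, hy, rfl⟩ hyB
        exact disjoint_left.1 hCB hy hyB
      · exact (disjoint_image_iff Subtype.val_injective).2 disjoint_compl_right)
  refine ⟨U, V, hU, hV, subset_union_left.trans hAU, subset_union_left.trans hBV, hUV, ?_⟩
  intro y hy
  by_cases hyC : (⟨y, hy⟩ : F) ∈ C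
  · exact .inl (hAU (.inr ⟨_, hyC, rfl⟩))
  · exact .inr (hBV (.inr ⟨_, hyC, rfl⟩))

/-- The countable sum theorem in dimension zero. -/
theorem isZeroDim_of_iUnion_eq_univ {Y : Type*} [TopologicalSpace Y] [T4Space Y]
    [SecondCountableTopology Y] {F : ℕ → Set Y} (hF : ∀ n, IsClosed (F n))
    (hF0 : ∀ n, IsZeroDim (F n)) (hcov : ⋃ n, F n = univ) : IsZeroDim Y := by
  rw [isZeroDim_iff]
  intro y O hy hO
  obtain ⟨U₀, V₀, hU₀, hV₀, hyU, hOV, hUV₀⟩ := exists_isOpen_disjoint_closure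
    (isClosed_singleton (x := y)) hO.isClosed_compl (by simpa using hy)
  -- Stage `n` enlarges the pair so that it absorbs `F n`. Keeping the closures disjoint allows the
  -- next stage, and in the limit the two unions partition the space.
  let P := {p : Set Y × Set Y // IsOpen p.1 ∧ IsOpen p.2 ∧ Disjoint (closure p.1) (closure p.2)}
  have step : ∀ (n : ℕ) (p : P), ∃ q : P,
      p.1.1 ⊆ q.1.1 ∧ p.1.2 ⊆ q.1.2 ∧ F n ⊆ q.1.1 ∪ q.1.2 := by
    intro n p
    obtain ⟨U, V, hU, hV, hpU, hpV, hUV, hFUV⟩ :=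
      (hF0 n).exists_isOpen_cover (hF n) isClosed_closure isClosed_closure p.2.2.2
    exact ⟨⟨(U, V), hU, hV, hUV⟩, subset_closure.trans hpU, subset_closure.trans hpV, hFUV⟩
  choose! g hg1 hg2 hg3 using step
  let p : ℕ → P := fun n ↦ Nat.rec ⟨(U₀, V₀), hU₀, hV₀, hUV₀⟩ g n
  have hp1 : Monotone fun n ↦ (p n).1.1 := monotone_nat_of_le_succ fun n ↦ hg1 n (p n)
  have hp2 : Monotone fun n ↦ (p n).1.2 := monotone_nat_of_le_succ fun n ↦ hg2 n (p n)
  have hdisj : Disjoint (⋃ n, (p n).1.1) (⋃ n, (p n).1.2) := by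
    simp only [disjoint_iUnion_left, disjoint_iUnion_right]
    intro m n
    exact ((p (max m n)).2.2.2.mono subset_closure subset_closure).mono
      (hp1 (le_max_right _ _)) (hp2 (le_max_left _ _))
  have hcompl : (⋃ n, (p n).1.1)ᶜ = ⋃ n, (p n).1.2 := by
    refine subset_antisymm (fun z hz ↦ ?_) (disjoint_right.1 hdisj)
    obtain ⟨n, hn⟩ := mem_iUnion.1 (hcov.symm.subset (mem_univ z))
    rcases hg3 n (p n) hn with h | h
    · exact absurd (mem_iUnion.2 ⟨n + 1, h⟩) hz
    · exact mem_iUnion.2 ⟨n + 1, h⟩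
  refine ⟨⋃ n, (p n).1.1, ⟨?_, isOpen_iUnion fun n ↦ (p n).2.1⟩, mem_iUnion.2 ⟨0, hyU rfl⟩, ?_⟩
  · rw [← isOpen_compl_iff, hcompl]
    exact isOpen_iUnion fun n ↦ (p n).2.2.1
  · intro z hz
    by_contra hzO
    exact disjoint_left.1 hdisj hz (mem_iUnion.2 ⟨0, hOV hzO⟩)

/-- A closed set covered by countably many closed zero-dimensional sets is zero-dimensional. -/
theorem isZeroDim_of_subset_iUnion {X ι : Type*} [TopologicalSpace X] [MetrizableSpace X]
    [SecondCountableTopology X] [Countable ι] {F : ι → Set X} (hF : ∀ n, IsClosed (F n))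
    (hF0 : ∀ n, IsZeroDim (F n)) {G : Set X} (hG : G ⊆ ⋃ n, F n) : IsZeroDim G := by
  rcases isEmpty_or_nonempty ι with h | h
  · have : IsEmpty G := by simpa using hG
    exact isZeroDim_iff.2 fun y ↦ this.elim y
  obtain ⟨g, hg⟩ := exists_surjective_nat ι
  refine isZeroDim_of_iUnion_eq_univ (F := fun n ↦ ((↑) ⁻¹' F (g n) : Set G))
    (fun n ↦ (hF _).preimage continuous_subtype_val) (fun n ↦ ?_) ?_
  · let j : ((↑) ⁻¹' F (g n) : Set G) → F (g n) := fun z ↦ ⟨z.1.1, z.2⟩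
    refine IsZeroDim.of_isInducing (g := j) ?_ (hF0 (g n))
    have h : IsInducing fun z : ((↑) ⁻¹' F (g n) : Set G) ↦ (z.1 : X) :=
      IsInducing.subtypeVal.comp IsInducing.subtypeVal
    exact IsInducing.subtypeVal.of_comp_iff.1 h
  · ext z
    obtain ⟨i, hi⟩ := mem_iUnion.1 (hG z.2)
    obtain ⟨n, rfl⟩ := hg i
    simpa using ⟨n, hi⟩

/-! ### Hausdorff limits and `σ`-ideals of closed sets. -/

/-- The closure of a union of sets that get close to a closed set `F`. -/
theorem closure_iUnion_subset_of_infEDist_le {X : Type*} [PseudoEMetricSpace X] {F : Set X}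
    (hF : IsClosed F) {A : ℕ → Set X} {ε : ℕ → ℝ≥0∞} (hε : Tendsto ε atTop (𝓝 0))
    (hA : ∀ k, ∀ p ∈ A k, infEDist p F ≤ ε k) :
    closure (⋃ k, A k) ⊆ F ∪ ⋃ k, closure (A k) := by
  intro p hp
  by_contra hpF
  simp only [mem_union, mem_iUnion, not_or, not_exists] at hpF
  have h0 : 0 < infEDist p F := by
    rw [pos_iff_ne_zero, Ne, ← mem_closure_iff_infEDist_zero, hF.closure_eq]
    exact hpF.1
  obtain ⟨δ, hδ0, hδ⟩ := exists_between h0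
  obtain ⟨N, hN⟩ := (hε.eventually (gt_mem_nhds hδ0)).exists_forall_of_atTop
  -- All but finitely many `A k` lie in the closed `δ`-neighbourhood of `F`, which omits `p`.
  have hsub : ⋃ k, A k ⊆ (⋃ k ∈ Iio N, closure (A k)) ∪ {q | infEDist q F ≤ δ} := by
    intro q hq
    obtain ⟨k, hk⟩ := mem_iUnion.1 hq
    rcases lt_or_ge k N with h | h
    · exact .inl (mem_biUnion h (subset_closure hk))
    · exact .inr ((hA k q hk).trans (hN k h).le)
  have hcl : IsClosed ((⋃ k ∈ Iio N, closure (A k)) ∪ {q | infEDist q F ≤ δ}) :=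
    ((finite_Iio N).isClosed_biUnion fun _ _ ↦ isClosed_closure).union
      (isClosed_le continuous_infEDist continuous_const)
  rcases closure_minimal hsub hcl hp with h | h
  · obtain ⟨k, -, hk⟩ := mem_iUnion₂.1 h
    exact hpF.2 k hk
  · exact absurd h (not_le.2 hδ)

/-- Inclusion of closed sets is preserved by limits for the Hausdorff edistance. -/
theorem le_of_tendsto_closeds {X ι : Type*} [EMetricSpace X] {l : Filter ι} [l.NeBot]
    {u v : ι → Closeds X} {F G : Closeds X} (hu : Tendsto u l (𝓝 F)) (hv : Tendsto v l (𝓝 G))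
    (huv : ∀ᶠ i in l, u i ≤ v i) : F ≤ G := by
  intro p hp
  have hlim : Tendsto (fun i ↦ edist (u i) F + edist (v i) G) l (𝓝 0) := by
    simpa using (tendsto_iff_edist_tendsto_0.1 hu).add (tendsto_iff_edist_tendsto_0.1 hv)
  have hle : ∀ᶠ i in l, infEDist p G ≤ edist (u i) F + edist (v i) G := by
    filter_upwards [huv] with i hi
    calc infEDist p G ≤ infEDist p (v i) + hausdorffEDist (v i : Set X) G :=
          infEDist_le_infEDist_add_hausdorffEDist
      _ ≤ infEDist p (u i) + hausdorffEDist (v i : Set X) G := by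
          gcongr
      _ ≤ hausdorffEDist (F : Set X) (u i) + hausdorffEDist (v i : Set X) G := by
          gcongr; exact infEDist_le_hausdorffEDist_of_mem hp
      _ = edist (u i) F + edist (v i) G := by rw [hausdorffEDist_comm]; rfl
  have h0 : infEDist p G = 0 := le_antisymm (ge_of_tendsto hlim hle) zero_le
  rwa [← mem_closure_iff_infEDist_zero, G.isClosed.closure_eq] at h0

/-- A family of closed sets is a `σ`-ideal if it contains every closed set that is covered by
countably many of its members. -/
def IsSigmaIdeal {X : Type*} [TopologicalSpace X] (I : Set (Closeds X)) : Prop :=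
  ∀ (F : ℕ → Closeds X) (G : Closeds X), (∀ n, F n ∈ I) → (G : Set X) ⊆ ⋃ n, F n → G ∈ I

theorem IsSigmaIdeal.mem_of_subset_iUnion {X ι : Type*} [TopologicalSpace X] [Countable ι]
    [Nonempty ι] {I : Set (Closeds X)} (hI : IsSigmaIdeal I) {F : ι → Closeds X} {G : Closeds X}
    (hF : ∀ i, F i ∈ I) (hG : (G : Set X) ⊆ ⋃ i, F i) : G ∈ I := by
  obtain ⟨g, hg⟩ := exists_surjective_nat ι
  exact hI (F ∘ g) G (fun n ↦ hF _) (by simpa [hg.iUnion_comp fun i ↦ (F i : Set X)] using hG)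

theorem IsSigmaIdeal.mem_of_le {X : Type*} [TopologicalSpace X] {I : Set (Closeds X)}
    (hI : IsSigmaIdeal I) {F G : Closeds X} (hF : F ∈ I) (hG : G ≤ F) : G ∈ I :=
  hI (fun _ ↦ F) G (fun _ ↦ hF) (by rw [iUnion_const]; exact hG)

/-! ### Analytic `σ`-ideals are `G_δ`. -/

/-- A countable family of open sets has a point-finite open shrinking with the same union. -/
theorem exists_pointFinite_refinement {Y : Type*} [PseudoEMetricSpace Y] (O : ℕ → Set Y)
    (hO : ∀ m, IsOpen (O m)) :
    ∃ W : ℕ → Set Y, (∀ m, IsOpen (W m)) ∧ (∀ m, W m ⊆ O m) ∧ (⋃ m, O m) ⊆ ⋃ m, W m ∧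
      ∀ p, {m | p ∈ W m}.Finite := by
  choose C hC hCO hCU hmono using fun m ↦ (hO m).exists_iUnion_isClosed
  -- With `C j k` an increasing closed exhaustion of `O j`, a point of `C j k` is removed from every
  -- set of index above `max j k`, while the first `O m` containing a point keeps it.
  refine ⟨fun m ↦ O m \ ⋃ j ∈ Iio m, C j m, fun m ↦ ?_, fun m ↦ sdiff_subset, ?_, ?_⟩
  · exact (hO m).sdiff ((finite_Iio m).isClosed_biUnion fun j _ ↦ hC j m)
  · intro p hp
    classical
    have hex : ∃ m, p ∈ O m := by simpa using hp
    refine mem_iUnion.2 ⟨Nat.find hex, Nat.find_spec hex, ?_⟩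
    simp only [mem_iUnion, not_exists]
    exact fun j hj hp' ↦ Nat.find_min hex hj (hCO _ _ hp')
  · intro p
    by_cases hex : ∃ j, p ∈ O j
    · obtain ⟨j, hj⟩ := hex
      obtain ⟨k, hk⟩ := mem_iUnion.1 ((hCU j).symm.subset hj)
      refine (finite_Iic (max j k)).subset fun m hm ↦ ?_
      by_contra hlt
      have hlt : max j k < m := not_le.1 hlt
      exact hm.2 (mem_biUnion (show j < m from (le_max_left _ _).trans_lt hlt)
        (hmono j ((le_max_right j k).trans hlt.le) hk))
    · convert finite_empty
      exact eq_empty_of_forall_notMem fun m hm ↦ hex ⟨m, hm.1⟩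

/-- König's lemma for a family of sets of finite sequences (with the last entry at the head). -/
theorem exists_branch_of_finite {T : Set (List ℕ)} (hT : ∀ m s, m :: s ∈ T → s ∈ T)
    (hfin : ∀ s, {m | m :: s ∈ T}.Finite) (hlen : ∀ n, ∃ s ∈ T, s.length = n) :
    ∃ x : ℕ → ℕ, ∀ n, PiNat.res x n ∈ T := by
  let good : List ℕ → Prop := fun s ↦ ∀ n, ∃ t, t ++ s ∈ T ∧ n ≤ t.length
  have happ : ∀ t s, t ++ s ∈ T → s ∈ T := by
    intro t s
    induction t with
    | nil => exact id
    | cons m t ih => exact fun h ↦ ih (hT _ _ h)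
  have h0 : good [] := fun n ↦ by
    obtain ⟨s, hs, rfl⟩ := hlen n
    exact ⟨s, by simpa using hs, le_rfl⟩
  have hstep : ∀ s, good s → ∃ m, good (m :: s) := by
    intro s hs
    by_contra! hbad
    simp only [good, not_forall, not_exists, not_and, not_le] at hbad
    choose N hN using hbad
    obtain ⟨M, hM⟩ := ((hfin s).image N).bddAbove
    obtain ⟨t, ht, htl⟩ := hs (M + 1)
    obtain ⟨t', m, rfl⟩ : ∃ t' m, t = t' ++ [m] :=
      ⟨t.dropLast, t.getLast (by rintro rfl; simp at htl), (List.dropLast_append_getLast _).symm⟩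
    have ht' : t' ++ (m :: s) ∈ T := by simpa using ht
    have h1 := hN m t' ht'
    have h2 : N m ≤ M := hM ⟨m, happ _ _ ht', rfl⟩
    simp at htl
    omega
  choose! g hg using hstep
  let r : ℕ → List ℕ := fun n ↦ Nat.rec [] (fun _ s ↦ g s :: s) n
  have hr : ∀ n, good (r n) := fun n ↦ by
    induction n with
    | zero => exact h0
    | succ n ih => exact hg _ ih
  have hres : ∀ n, PiNat.res (fun n ↦ g (r n)) n = r n := fun n ↦ by
    induction n with
    | zero => rfl
    | succ n ih => rw [PiNat.res_succ, ih]
  refine ⟨fun n ↦ g (r n), fun n ↦ ?_⟩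
  obtain ⟨t, ht, -⟩ := hr n 0
  rw [hres]
  exact happ _ _ ht

theorem forall₂_le_res_iff {x y : ℕ → ℕ} {n : ℕ} :
    List.Forall₂ (· ≤ ·) (PiNat.res y n) (PiNat.res x n) ↔ ∀ i < n, y i ≤ x i := by
  induction n with
  | zero => simp
  | succ n ih =>
    rw [PiNat.res_succ, PiNat.res_succ, List.forall₂_cons, ih]
    constructor
    · rintro ⟨h1, h2⟩ i hi
      rcases Nat.lt_succ_iff_lt_or_eq.1 hi with h | rfl
      exacts [h2 i h, h1]
    · exact fun h ↦ ⟨h n n.lt_succ_self, fun i hi ↦ h i (hi.trans n.lt_succ_self)⟩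

/-- An eventually dominated sequence in the Baire space has a convergent subsequence. -/
theorem exists_tendsto_subseq_of_le {x : ℕ → ℕ} {y : ℕ → ℕ → ℕ} (h : ∀ n, ∀ i < n, y n i ≤ x i) :
    ∃ z, ∃ φ : ℕ → ℕ, StrictMono φ ∧ Tendsto (y ∘ φ) atTop (𝓝 z) := by
  -- Truncation by `x` moves the sequence into a compact box and changes no coordinate of `y n`
  -- below `n`, so the limit is the same.
  obtain ⟨z, -, φ, hφ, hz⟩ := (isCompact_Icc (a := (0 : ℕ → ℕ)) (b := x)).tendsto_subseq
    (x := fun n ↦ y n ⊓ x) fun n ↦ ⟨fun i ↦ Nat.zero_le _, inf_le_right⟩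
  refine ⟨z, φ, hφ, tendsto_pi_nhds.2 fun i ↦ ?_⟩
  refine (tendsto_pi_nhds.1 hz i).congr' ?_
  filter_upwards [eventually_gt_atTop i] with n hn
  exact min_eq_left (h (φ n) i (hn.trans_le hφ.le_apply))

/-- An analytic `σ`-ideal of closed sets is `G_δ`. -/
theorem IsSigmaIdeal.isGδ_of_analyticSet {X : Type*} [EMetricSpace X] {I : Set (Closeds X)}
    (hI : IsSigmaIdeal I) (hA : AnalyticSet I) : IsGδ I := by
  rw [AnalyticSet] at hA
  rcases hA with rfl | ⟨f, hf, rfl⟩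
  · exact .empty
  set I := range f
  let J : List ℕ → Set (Closeds X) := fun s ↦
    {F | ∃ y, List.Forall₂ (· ≤ ·) (PiNat.res y s.length) s ∧ F ≤ f y}
  let O : Set (Closeds X) → List ℕ → ℕ → Set (Closeds X) := fun W s m ↦
    ⋃₀ {V | IsOpen V ∧ V ⊆ W ∧ V ∩ I ⊆ J (m :: s)}
  have hO : ∀ W s m, IsOpen (O W s m) := fun W s m ↦ isOpen_sUnion fun V hV ↦ hV.1
  have hOW : ∀ W s m, O W s m ⊆ W := fun W s m ↦ sUnion_subset fun V hV ↦ hV.2.1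
  have hOJ : ∀ W s m, O W s m ∩ I ⊆ J (m :: s) := by
    rintro W s m F ⟨⟨V, hV, hFV⟩, hF⟩
    exact hV.2.2 ⟨hFV, hF⟩
  have hcov : ∀ (W : Set (Closeds X)) (s : List ℕ), IsOpen W → W ∩ I ⊆ J s →
      W ∩ I ⊆ ⋃ m, O W s m := by
    -- If no neighbourhood of `F` works for any `m`, choose for each `m` a bad `G m ∈ I` within `δ
    -- m` of `F`. Their union with `F` is some `H ∈ W ∩ I`, so `H ≤ f y` with `y` dominated by `s`;
    -- then `m = y s.length` contradicts the choice of `G m`.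
    rintro W s hW hWJ F ⟨hFW, hFI⟩
    by_contra hF
    simp only [mem_iUnion, not_exists] at hF
    obtain ⟨ε, hε0, hε⟩ := EMetric.mem_nhds_iff.1 (hW.mem_nhds hFW)
    obtain ⟨δ, hδanti, hδ, hδ0⟩ := exists_seq_strictAnti_tendsto' hε0
    have key : ∀ m, ∃ G ∈ I, edist G F < δ m ∧ G ∉ J (m :: s) := by
      intro m
      by_contra! hno
      refine hF m ⟨eball F (δ m), ⟨isOpen_eball, ?_, ?_⟩, mem_eball_self (hδ m).1⟩
      · exact (eball_subset_eball (hδ m).2.le).trans hε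
      · exact fun G hG ↦ hno G hG.2 hG.1
    choose G hGI hGF hGJ using key
    let H : Closeds X := F ⊔ Closeds.closure (⋃ m, (G m : Set X))
    have hGH : ∀ m, G m ≤ H := fun m p hp ↦ .inr (subset_closure (mem_iUnion.2 ⟨m, hp⟩))
    have hGinf : ∀ m, ∀ p ∈ G m, infEDist p F ≤ δ m := fun m p hp ↦
      (infEDist_le_hausdorffEDist_of_mem hp).trans (hGF m).le
    have hHI : H ∈ I := by
      refine hI.mem_of_subset_iUnion (F := fun o : Option ℕ ↦ o.elim F G) ?_ ?_
      · rintro (_ | m)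
        exacts [hFI, hGI _]
      · have h1 := closure_iUnion_subset_of_infEDist_le F.isClosed hδ0 hGinf
        rw [iUnion_option]
        rintro p (hp | hp)
        · exact .inl hp
        · rcases h1 hp with h | h
          · exact .inl h
          · obtain ⟨m, hm⟩ := mem_iUnion.1 h
            rw [(G m).isClosed.closure_eq] at hm
            exact .inr (mem_iUnion.2 ⟨m, hm⟩)
    have hHF : edist H F ≤ δ 0 := by
      refine hausdorffEDist_le_of_infEDist ?_ fun p hp ↦ ?_
      · have h1 : closure (⋃ m, (G m : Set X)) ⊆ {q | infEDist q F ≤ δ 0} :=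
          closure_minimal (iUnion_subset fun m p hp ↦
            (hGinf m p hp).trans (hδanti.antitone (Nat.zero_le m)))
            (isClosed_le continuous_infEDist continuous_const)
        rintro p (hp | hp)
        · rw [infEDist_zero_of_mem hp]; exact zero_le
        · exact h1 hp
      · rw [infEDist_zero_of_mem (show p ∈ (H : Set X) from .inl hp)]; exact zero_le
    obtain ⟨y, hy, hHy⟩ := hWJ ⟨hε (hHF.trans_lt (hδ 0).2), hHI⟩
    exact hGJ (y s.length) ⟨y, by simpa using hy, (hGH _).trans hHy⟩
  choose R hRo hRO hRcov hRfin using fun W s ↦ exists_pointFinite_refinement (O W s) (hO W s)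
  let W : List ℕ → Set (Closeds X) := fun s ↦ List.rec univ (fun m s V ↦ R V s m) s
  have hWo : ∀ s, IsOpen (W s) := by
    rintro (_ | ⟨m, s⟩)
    exacts [isOpen_univ, hRo _ _ _]
  have hWJ : ∀ s, W s ∩ I ⊆ J s := by
    rintro (_ | ⟨m, s⟩)
    · rintro _ ⟨-, y, rfl⟩
      exact ⟨y, by simp, le_rfl⟩
    · exact (inter_subset_inter_left _ (hRO _ _ _)).trans (hOJ _ _ _)
  have hlevel : ∀ n, ∀ F ∈ I, ∃ s, F ∈ W s ∧ s.length = n := by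
    intro n F hF
    induction n with
    | zero => exact ⟨[], mem_univ _, rfl⟩
    | succ n ih =>
      obtain ⟨s, hs, rfl⟩ := ih
      obtain ⟨m, hm⟩ := mem_iUnion.1 (hRcov _ _ (hcov (W s) s (hWo s) (hWJ s) ⟨hs, hF⟩))
      exact ⟨m :: s, hm, rfl⟩
  -- Point-finiteness makes the tree of `s` with `F ∈ W s` finitely branching, so `F` has a branch
  -- `x`. Members of `I` in `W (x|n)` tending to `F` lie below `f (y n)` with `y n` dominated by `x`
  -- on its first `n` coordinates.
  have hmain : I = closure I ∩ ⋂ n, ⋃ s ∈ {s : List ℕ | s.length = n}, W s := by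
    apply subset_antisymm
    · refine fun F hF ↦ ⟨subset_closure hF, mem_iInter.2 fun n ↦ ?_⟩
      obtain ⟨s, hs, hn⟩ := hlevel n F hF
      exact mem_biUnion (show s ∈ {s : List ℕ | s.length = n} from hn) hs
    rintro F ⟨hFcl, hF⟩
    obtain ⟨x, hx⟩ := exists_branch_of_finite (T := {s | F ∈ W s})
      (fun m s h ↦ hOW _ _ _ (hRO _ _ _ h)) (fun s ↦ hRfin _ _ F) fun n ↦ by
        obtain ⟨s, hs, hsF⟩ := mem_iUnion₂.1 (mem_iInter.1 hF n)
        exact ⟨s, hsF, hs⟩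
    obtain ⟨δ, -, hδ, hδ0⟩ := exists_seq_strictAnti_tendsto' (zero_lt_one (α := ℝ≥0∞))
    have hex : ∀ n, ∃ G ∈ I, edist G F < δ n ∧ G ∈ W (PiNat.res x n) := by
      intro n
      obtain ⟨G, ⟨h1, h2⟩, h3⟩ := mem_closure_iff.1 hFcl (eball F (δ n) ∩ W (PiNat.res x n))
        (isOpen_eball.inter (hWo _)) ⟨mem_eball_self (hδ n).1, hx n⟩
      exact ⟨G, h3, h1, h2⟩
    choose G hGI hGF hGW using hex
    choose y hy hGy using fun n ↦ hWJ _ ⟨hGW n, hGI n⟩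
    simp only [PiNat.res_length, forall₂_le_res_iff] at hy
    obtain ⟨z, φ, hφ, hz⟩ := exists_tendsto_subseq_of_le hy
    have hG : Tendsto G atTop (𝓝 F) := by
      rw [tendsto_iff_edist_tendsto_0]
      exact tendsto_of_tendsto_of_tendsto_of_le_of_le tendsto_const_nhds hδ0
        (fun _ ↦ zero_le) fun n ↦ (hGF n).le
    exact hI.mem_of_le ⟨z, rfl⟩ (le_of_tendsto_closeds (hG.comp hφ.tendsto_atTop)
      ((hf.tendsto z).comp hz) (.of_forall fun n ↦ hGy (φ n)))
  rw [hmain]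
  exact isClosed_closure.isGδ.inter (.iInter_of_isOpen fun n ↦ isOpen_biUnion fun s _ ↦ hWo s)

/-! ### Hurewicz schemes and coanalytic hardness. -/

/-- A Hurewicz scheme in a family `I` of closed sets whose complement is analytic and which is not
`G_δ`: members of `I` indexed by finite sequences and converging to the limits of their successors,
while the limits along infinite branches are outside `I`. -/
theorem exists_hurewicz_scheme {Y : Type*} [PseudoEMetricSpace Y] {I : Set Y}
    (hA : AnalyticSet Iᶜ) (hI : ¬ IsGδ I) :
    ∃ F : List ℕ → Y, (∀ s, F s ∈ I) ∧
      (∀ t k s, edist (F (t ++ k :: s)) (F s) ≤ 2⁻¹ ^ (k + s.length)) ∧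
      ∀ x : ℕ → ℕ, ∃ G ∉ I, Tendsto (fun n ↦ F (PiNat.res x n)) atTop (𝓝 G) := by
  rw [AnalyticSet] at hA
  rcases hA with h | ⟨f, hf, hfI⟩
  · exact absurd ((compl_empty_iff.1 h).symm ▸ IsGδ.univ) hI
  have hfI' : ∀ w, f w ∉ I := fun w ↦ hfI.subset ⟨w, rfl⟩
  -- The part of the complement parametrized by `S` can be cut off from `I` by a `G_δ` set. This
  -- property is stable under countable unions, and fails for the whole Baire space as `I` is not
  -- `G_δ`.
  let Sep : Set (ℕ → ℕ) → Prop := fun S ↦ ∃ G, IsGδ G ∧ I ⊆ G ∧ Disjoint G (f '' S)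
  have hSep_biUnion : ∀ (t : Set (ℕ → ℕ)) (S : (ℕ → ℕ) → Set (ℕ → ℕ)), t.Countable →
      (∀ z ∈ t, Sep (S z)) → Sep (⋃ z ∈ t, S z) := by
    intro t S ht hS
    choose! G hG1 hG2 hG3 using hS
    refine ⟨⋂ z ∈ t, G z, .biInter ht hG1, subset_iInter₂ hG2, ?_⟩
    rw [image_iUnion₂, disjoint_iUnion₂_right]
    exact fun z hz ↦ (hG3 z hz).mono_left (biInter_subset_of_mem hz)
  have hSep_union : ∀ S T, Sep S → Sep T → Sep (S ∪ T) := by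
    rintro S T ⟨G, hG1, hG2, hG3⟩ ⟨H, hH1, hH2, hH3⟩
    refine ⟨G ∩ H, hG1.inter hH1, subset_inter hG2 hH2, ?_⟩
    rw [image_union, disjoint_union_right]
    exact ⟨hG3.mono_left inter_subset_left, hH3.mono_left inter_subset_right⟩
  have hSep_mono : ∀ S T, S ⊆ T → Sep T → Sep S := by
    rintro S T hST ⟨G, hG1, hG2, hG3⟩
    exact ⟨G, hG1, hG2, hG3.mono_right (image_mono hST)⟩
  let Z : Set (ℕ → ℕ) := {z | ∀ n, ¬ Sep (PiNat.cylinder z n)}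
  have hZc : Sep Zᶜ := by
    have h : ∀ z ∈ Zᶜ, ∃ n, Sep (PiNat.cylinder z n) := fun z hz ↦ by simpa [Z] using hz
    choose! n hn using h
    obtain ⟨t, htZ, ht, hcov⟩ := countable_cover_nhdsWithin (s := Zᶜ)
      (f := fun z ↦ PiNat.cylinder z (n z)) fun z _ ↦ mem_nhdsWithin_of_mem_nhds
        ((PiNat.isOpen_cylinder _ z (n z)).mem_nhds (PiNat.self_mem_cylinder z _))
    exact hSep_mono _ _ hcov (hSep_biUnion t _ ht fun z hz ↦ hn z (htZ hz))
  -- Otherwise the complement of the closure is an open set separating `cylinder ∩ Z` from `I`. As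
  -- `Zᶜ` is separated too, so would be the entire cylinder.
  have hmeet : ∀ z ∈ Z, ∀ n, ∃ F ∈ I, F ∈ closure (f '' (PiNat.cylinder z n ∩ Z)) := by
    intro z hz n
    by_contra! hno
    refine hz n (hSep_mono _ _ (fun w hw ↦ ?_) (hSep_union (PiNat.cylinder z n ∩ Z) _
      ⟨(closure (f '' (PiNat.cylinder z n ∩ Z)))ᶜ, isClosed_closure.isOpen_compl.isGδ, hno, ?_⟩
      hZc))
    · by_cases hwZ : w ∈ Z
      exacts [.inl ⟨hw, hwZ⟩, .inr hwZ]
    · exact disjoint_compl_left.mono_right subset_closure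
  obtain ⟨z₀, hz₀⟩ : Z.Nonempty := by
    by_contra hZ
    rw [not_nonempty_iff_eq_empty] at hZ
    obtain ⟨G, hG1, hG2, hG3⟩ := hZc
    rw [hZ, compl_empty, image_univ, hfI, disjoint_compl_right_iff_subset] at hG3
    exact hI (hG2.antisymm hG3 ▸ hG1)
  let N := {q : (ℕ → ℕ) × ℕ × Y // q.1 ∈ Z ∧ q.2.2 ∈ I ∧
    q.2.2 ∈ closure (f '' (PiNat.cylinder q.1 q.2.1 ∩ Z))}
  let cyl : N → Set (ℕ → ℕ) := fun q ↦ PiNat.cylinder q.1.1 q.1.2.1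
  -- Approximate the member of `I` at `q` by some `f w` with `w` in its cylinder and in `Z`, then
  -- shrink to a cylinder around `w` that `f` maps near that member.
  have step : ∀ (q : N) (δ : ℝ≥0∞), 0 < δ → ∃ q' : N, q'.1.1 ∈ cyl q ∧ q.1.2.1 < q'.1.2.1 ∧
      ∀ w ∈ cyl q', edist (f w) q.1.2.2 ≤ δ := by
    rintro ⟨⟨z, n, F⟩, hz, hF, hFcl⟩ δ hδ
    obtain ⟨_, ⟨w, ⟨hwz, hwZ⟩, rfl⟩, hw⟩ := EMetric.mem_closure_iff.1 hFcl δ hδ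
    obtain ⟨_, ⟨v, m, rfl⟩, hwv, hvm⟩ := (PiNat.isTopologicalBasis_cylinders
      (E := fun _ ↦ ℕ)).exists_subset_of_mem_open (show w ∈ f ⁻¹' eball F δ by
        simpa [edist_comm] using hw) (isOpen_eball.preimage hf)
    rw [← PiNat.mem_cylinder_iff_eq.1 hwv] at hvm
    obtain ⟨F', hF', hF'cl⟩ := hmeet w hwZ (max m (n + 1))
    exact ⟨⟨(w, max m (n + 1), F'), hwZ, hF', hF'cl⟩, hwz,
      lt_of_lt_of_le n.lt_succ_self (le_max_right m (n + 1)), fun u hu ↦ (hvm (PiNat.cylinder_anti _ (le_max_left _ _) hu)).le⟩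
  choose! g hg1 hg2 hg3 using step
  -- In the exponent `k + s.length`, the term `k` makes the successors of `s` converge to its
  -- member, and `s.length` makes the members along a branch converge to `f w`, where `w` is the
  -- common point of the cylinders.
  let node : List ℕ → N := fun s ↦ List.rec
    ⟨(z₀, 0, (hmeet z₀ hz₀ 0).choose), hz₀, (hmeet z₀ hz₀ 0).choose_spec⟩
    (fun k s q ↦ g q (2⁻¹ ^ (k + s.length))) s
  have hpos : ∀ n : ℕ, (0 : ℝ≥0∞) < 2⁻¹ ^ n := fun n ↦ ENNReal.pow_pos (by simp) n
  have hcyl1 : ∀ k s, cyl (node (k :: s)) ⊆ cyl (node s) := by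
    intro k s
    have h1 : cyl (node s) = PiNat.cylinder (node (k :: s)).1.1 (node s).1.2.1 :=
      (PiNat.mem_cylinder_iff_eq.1 (hg1 (node s) _ (hpos (k + s.length)))).symm
    rw [h1]
    exact PiNat.cylinder_anti _ (hg2 (node s) _ (hpos (k + s.length))).le
  have hcyl : ∀ t s, cyl (node (t ++ s)) ⊆ cyl (node s) := by
    intro t s
    induction t with
    | nil => exact subset_rfl
    | cons k t ih => exact (hcyl1 k (t ++ s)).trans ih
  have hlen : ∀ s, s.length ≤ (node s).1.2.1 := by
    intro s
    induction s with
    | nil => exact Nat.zero_le _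
    | cons k s ih => exact ih.trans_lt (hg2 (node s) _ (hpos (k + s.length)))
  refine ⟨fun s ↦ (node s).1.2.2, fun s ↦ (node s).2.2.1, fun t k s ↦ ?_, fun x ↦ ?_⟩
  · have h1 : f '' (cyl (node (t ++ k :: s)) ∩ Z) ⊆
        {G | edist G (node s).1.2.2 ≤ 2⁻¹ ^ (k + s.length)} := by
      rintro _ ⟨w, ⟨hw, -⟩, rfl⟩
      exact hg3 (node s) _ (hpos _) w (hcyl t (k :: s) hw)
    exact closure_minimal h1 (isClosed_le (continuous_id.edist continuous_const)
      continuous_const) (node (t ++ k :: s)).2.2.2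
  · let w : ℕ → ℕ := fun i ↦ (node (PiNat.res x (i + 1))).1.1 i
    have hw : ∀ n, w ∈ cyl (node (PiNat.res x n)) := by
      intro n
      refine PiNat.mem_cylinder_iff.2 fun i hi ↦ ?_
      have hanti : Antitone fun n ↦ cyl (node (PiNat.res x n)) :=
        antitone_nat_of_succ_le fun n ↦ hcyl1 (x n) (PiNat.res x n)
      have hmem : ∀ k ≤ max n (i + 1), (node (PiNat.res x (max n (i + 1)))).1.1 ∈
          cyl (node (PiNat.res x k)) := fun k hk ↦ hanti hk (PiNat.self_mem_cylinder _ _)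
      have hi' : i < (node (PiNat.res x (i + 1))).1.2.1 :=
        Nat.lt_of_succ_le ((PiNat.res_length x (i + 1)).symm.trans_le (hlen _))
      rw [← PiNat.mem_cylinder_iff.1 (hmem n (le_max_left _ _)) i hi,
        PiNat.mem_cylinder_iff.1 (hmem (i + 1) (le_max_right _ _)) i hi']
    refine ⟨f w, hfI' w, tendsto_iff_edist_tendsto_0.2 ?_⟩
    refine tendsto_of_tendsto_of_tendsto_of_le_of_le tendsto_const_nhds
      (ENNReal.tendsto_pow_atTop_nhds_zero_of_lt_one (r := 2⁻¹) (by simp)) (fun _ ↦ zero_le)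
      fun n ↦ ?_
    rw [edist_comm]
    refine (hg3 (node (PiNat.res x n)) _ (hpos _) w (hw (n + 1))).trans ?_
    exact pow_le_pow_right_of_le_one' (by simp) (by
      rw [PiNat.res_length]; exact Nat.le_add_left _ _)

/-- Coanalytic subsets of the Cantor space are continuously reduced to well-foundedness of trees. -/
theorem IsCoanalytic.exists_trees {B : Set (ℕ → Bool)} (hB : IsCoanalytic B) :
    B = univ ∨ ∃ T : (ℕ → Bool) → Set (List ℕ),
      (∀ α k s, k :: s ∈ T α → s ∈ T α) ∧
      (∀ α β s, (∀ i < s.length, α i = β i) → s ∈ T α → s ∈ T β) ∧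
      ∀ α, α ∈ B ↔ ∀ x : ℕ → ℕ, ∃ n, PiNat.res x n ∉ T α := by
  rw [IsCoanalytic, AnalyticSet] at hB
  rcases hB with h | ⟨g, hg, hgB⟩
  · exact .inl (compl_empty_iff.1 h)
  -- A branch `x` supplies points `y n → x` with `g (y n)` agreeing with `α` up to `n`, hence `g x =
  -- α` by continuity.
  refine .inr ⟨fun α ↦ {s | ∃ y, PiNat.res y s.length = s ∧ ∀ i < s.length, g y i = α i},
    ?_, ?_, fun α ↦ ?_⟩
  · rintro α k s ⟨y, hy, hyα⟩
    rw [List.length_cons, PiNat.res_succ, List.cons.injEq] at hy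
    exact ⟨y, hy.2, fun i hi ↦ hyα i (hi.trans s.length.lt_succ_self)⟩
  · rintro α β s hαβ ⟨y, hy, hyα⟩
    exact ⟨y, hy, fun i hi ↦ (hyα i hi).trans (hαβ i hi)⟩
  · rw [← not_iff_not, ← mem_compl_iff, ← hgB]
    push Not
    constructor
    · rintro ⟨x, rfl⟩
      exact ⟨x, fun n ↦ ⟨x, by rw [PiNat.res_length], fun i _ ↦ rfl⟩⟩
    · rintro ⟨x, hx⟩
      choose y hy hyα using hx
      simp only [PiNat.res_length] at hy hyα
      have hlim : Tendsto y atTop (𝓝 x) := by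
        refine tendsto_pi_nhds.2 fun i ↦ tendsto_const_nhds.congr' ?_
        filter_upwards [eventually_gt_atTop i] with n hn
        exact (PiNat.res_eq_res.1 (hy n) hn).symm
      refine ⟨x, funext fun i ↦ ?_⟩
      have h1 := tendsto_pi_nhds.1 ((hg.tendsto x).comp hlim) i
      refine tendsto_nhds_unique h1 (tendsto_const_nhds.congr' ?_)
      filter_upwards [eventually_gt_atTop i] with n hn
      exact (hyα n i hn).symm

/-- A `σ`-ideal of closed sets with analytic complement that is not `G_δ` is `𝚷¹₁`-hard. -/
theorem IsSigmaIdeal.isCoanalyticHard {X : Type*} [EMetricSpace X] {I : Set (Closeds X)}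
    (hI : IsSigmaIdeal I) (hA : AnalyticSet Iᶜ) (hG : ¬ IsGδ I) : IsCoanalyticHard I := by
  obtain ⟨F, hFI, hFF, hF⟩ := exists_hurewicz_scheme hA hG
  intro B hB
  rcases hB.exists_trees with rfl | ⟨T, hT1, hT2, hT3⟩
  · exact ⟨fun _ ↦ F [], continuous_const, eq_univ_of_forall fun _ ↦ hFI _⟩
  have htail : ∀ α t s, t ++ s ∈ T α → s ∈ T α := by
    intro α t s
    induction t with
    | nil => exact id
    | cons k t ih => exact fun h ↦ ih (hT1 _ _ _ h)
  let Φ : (ℕ → Bool) → Closeds X := fun α ↦ Closeds.closure (⋃ s ∈ T α, (F s : Set X))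
  have hΦ1 : ∀ α β (n : ℕ), (∀ i < n, α i = β i) → ∀ p ∈ (Φ α : Set X),
      infEDist p (Φ β : Set X) ≤ 2⁻¹ ^ n := by
    intro α β n hαβ
    refine closure_minimal ?_ (isClosed_le continuous_infEDist continuous_const)
    refine iUnion₂_subset fun s hs p hp ↦ ?_
    have hsub : ∀ t ∈ T β, (F t : Set X) ⊆ Φ β := fun t ht q hq ↦
      subset_closure (mem_biUnion ht hq)
    rcases le_or_gt s.length n with h | h
    · have hsβ : s ∈ T β := hT2 α β s (fun i hi ↦ hαβ i (hi.trans_le h)) hs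
      exact (infEDist_zero_of_mem (hsub s hsβ hp)).trans_le zero_le
    · obtain ⟨t, k, r, rfl, hr⟩ : ∃ t k r, s = t ++ k :: r ∧ r.length = n := by
        refine ⟨s.take (s.length - n - 1), s[s.length - n - 1], s.drop (s.length - n), ?_, ?_⟩
        · conv_lhs => rw [← List.take_append_drop (s.length - n - 1) s]
          rw [List.drop_eq_getElem_cons (by omega)]
          congr 3
          omega
        · rw [List.length_drop]; omega
      have hrβ : r ∈ T β := hT2 α β r (fun i hi ↦ hαβ i (hr ▸ hi))
        (htail α (t ++ [k]) r (by simpa using hs))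
      calc infEDist p (Φ β : Set X) ≤ infEDist p (F r) := infEDist_anti (hsub r hrβ)
        _ ≤ edist (F (t ++ k :: r)) (F r) := infEDist_le_hausdorffEDist_of_mem hp
        _ ≤ 2⁻¹ ^ (k + r.length) := hFF t k r
        _ ≤ 2⁻¹ ^ n := pow_le_pow_right_of_le_one' (by simp) (by omega)
  have hΦ : Continuous Φ := by
    refine continuous_iff_continuousAt.2 fun α ↦ EMetric.tendsto_nhds.2 fun ε hε ↦ ?_
    obtain ⟨n, hn⟩ := ((ENNReal.tendsto_pow_atTop_nhds_zero_of_lt_one (r := 2⁻¹)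
      (by simp)).eventually (gt_mem_nhds hε)).exists
    filter_upwards [(PiNat.isOpen_cylinder _ α n).mem_nhds (PiNat.self_mem_cylinder α n)] with β hβ
    refine lt_of_le_of_lt (hausdorffEDist_le_of_infEDist (hΦ1 β α n ?_) (hΦ1 α β n ?_)) hn
    exacts [fun i hi ↦ hβ i hi, fun i hi ↦ (hβ i hi).symm]
  refine ⟨Φ, hΦ, ?_⟩
  ext α
  rw [mem_preimage, hT3 α]
  constructor
  · intro hα x
    by_contra! hx
    obtain ⟨G, hGI, hG⟩ := hF x
    refine hGI (hI.mem_of_le hα (le_of_tendsto_closeds hG tendsto_const_nhds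
      (.of_forall fun n ↦ ?_)))
    exact fun p hp ↦ subset_closure (mem_biUnion (hx n) hp)
  · intro hα
    refine hI.mem_of_subset_iUnion hFI fun p hp ↦ ?_
    by_contra hpF
    simp only [mem_iUnion, not_exists] at hpF
    -- If `p` is in the closure of the members at extensions of `s` but not in `F s`, then it is in
    -- the closure for one immediate successor, because these families converge to `F s`. Iteration
    -- produces an infinite branch of `T α`.
    let A : List ℕ → Set X := fun s ↦ ⋃ t ∈ {t | t ++ s ∈ T α}, (F (t ++ s) : Set X)
    have hAmem : ∀ s, (A s).Nonempty → s ∈ T α := by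
      rintro s ⟨q, hq⟩
      obtain ⟨t, ht, -⟩ := mem_iUnion₂.1 hq
      exact htail α t s ht
    have hstep : ∀ s, p ∈ closure (A s) → ∃ k, p ∈ closure (A (k :: s)) := by
      intro s hs
      have h1 : A s ⊆ F s ∪ ⋃ k, A (k :: s) := by
        refine iUnion₂_subset fun t ht q hq ↦ ?_
        rcases List.eq_nil_or_concat t with rfl | ⟨t, k, rfl⟩
        · exact .inl hq
        · refine .inr (mem_iUnion.2 ⟨k, mem_biUnion (x := t) ?_ ?_⟩)
          · simpa using ht
          · simpa using hq
      have h2 := closure_mono h1 hs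
      rw [closure_union, (F s).isClosed.closure_eq] at h2
      have h3 := closure_iUnion_subset_of_infEDist_le (F s).isClosed (A := fun k ↦ A (k :: s))
        (ENNReal.tendsto_pow_atTop_nhds_zero_of_lt_one (r := 2⁻¹) (by simp)) (by
          rintro k q hq
          obtain ⟨t, -, hqt⟩ := mem_iUnion₂.1 hq
          exact ((infEDist_le_hausdorffEDist_of_mem hqt).trans (hFF t k s)).trans
            (pow_le_pow_right_of_le_one' (by simp) (Nat.le_add_right _ _)))
      simpa [hpF s] using h2.elim .inl fun h ↦ h3 h
    choose! g hg using hstep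
    let r : ℕ → List ℕ := fun n ↦ Nat.rec [] (fun _ s ↦ g s :: s) n
    have hr : ∀ n, p ∈ closure (A (r n)) := fun n ↦ by
      induction n with
      | zero => exact closure_mono (iUnion₂_subset fun s hs q hq ↦ mem_biUnion (x := s)
          (by simpa [r] using hs) (by simpa [r] using hq)) hp
      | succ n ih => exact hg _ ih
    have hres : ∀ n, PiNat.res (fun n ↦ g (r n)) n = r n := fun n ↦ by
      induction n with
      | zero => rfl
      | succ n ih => rw [PiNat.res_succ, ih]
    obtain ⟨n, hn⟩ := hα fun n ↦ g (r n)
    rw [hres] at hn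
    exact hn (hAmem _ (closure_nonempty_iff.1 ⟨p, hr n⟩))

/-! ### The `F_σ` case. -/

/-- A metrizable separable space that is not zero-dimensional has a nonempty closed subset whose
nonempty relatively open subsets have closures that are not zero-dimensional. -/
theorem exists_nowhere_zeroDim {X : Type*} [TopologicalSpace X] [MetrizableSpace X]
    [SecondCountableTopology X] (hX : ¬ IsZeroDim (univ : Set X)) :
    ∃ Y : Set X, IsClosed Y ∧ Y.Nonempty ∧
      ∀ V, IsOpen V → (V ∩ Y).Nonempty → ¬ IsZeroDim (closure (V ∩ Y)) := by
  -- Countably many open sets with zero-dimensional closure cover `U`. If `W ∩ Uᶜ` had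
  -- zero-dimensional closure, the sum theorem would make a smaller neighbourhood of each point of
  -- `W ∩ Uᶜ` have one too, putting that point in `U`.
  let U : Set X := {x | ∃ V, IsOpen V ∧ x ∈ V ∧ IsZeroDim (closure V)}
  have hU : IsOpen U := isOpen_iff_forall_mem_open.2 fun x ⟨V, hV, hxV, hV0⟩ ↦
    ⟨V, fun y hy ↦ ⟨V, hV, hy, hV0⟩, hV, hxV⟩
  have h : ∀ x ∈ U, ∃ V, IsOpen V ∧ x ∈ V ∧ IsZeroDim (closure V) := fun x hx ↦ hx
  choose! V hV hxV hV0 using h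
  obtain ⟨t, htU, ht, hcov⟩ := countable_cover_nhdsWithin (s := U) (f := V)
    fun x hx ↦ mem_nhdsWithin_of_mem_nhds ((hV x hx).mem_nhds (hxV x hx))
  have := ht.to_subtype
  refine ⟨Uᶜ, hU.isClosed_compl, ?_, fun W hW ⟨y, hyW, hyU⟩ h0 ↦ ?_⟩
  · by_contra hne
    rw [not_nonempty_iff_eq_empty, compl_empty_iff] at hne
    refine hX (isZeroDim_of_subset_iUnion (F := fun x : t ↦ closure (V x))
      (fun _ ↦ isClosed_closure) (fun x ↦ hV0 x (htU x.2)) fun x _ ↦ ?_)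
    obtain ⟨z, hz, hxz⟩ := mem_iUnion₂.1 (hcov (hne.symm.subset (mem_univ x)))
    exact mem_iUnion.2 ⟨⟨z, hz⟩, subset_closure hxz⟩
  · obtain ⟨W', hW', hyW', hcl⟩ :
        ∃ W', IsOpen W' ∧ y ∈ W' ∧ closure W' ⊆ W := by
      obtain ⟨K, hK, hKc, hKW⟩ := exists_mem_nhds_isClosed_subset (hW.mem_nhds hyW)
      exact ⟨interior K, isOpen_interior, mem_interior_iff_mem_nhds.2 hK,
        (closure_minimal interior_subset hKc).trans hKW⟩
    refine hyU ⟨W', hW', hyW', isZeroDim_of_subset_iUnion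
      (F := fun o : Option t ↦ o.elim (closure (W ∩ Uᶜ)) fun x ↦ closure (V x)) ?_ ?_ ?_⟩
    · rintro (_ | x) <;> exact isClosed_closure
    · rintro (_ | x)
      exacts [h0, hV0 x (htU x.2)]
    · intro x hx
      by_cases hxU : x ∈ U
      · obtain ⟨z, hz, hxz⟩ := mem_iUnion₂.1 (hcov hxU)
        exact mem_iUnion.2 ⟨some ⟨z, hz⟩, subset_closure hxz⟩
      · exact mem_iUnion.2 ⟨none, subset_closure ⟨hcl hx, hxU⟩⟩

/-- A set covered by finite families of pairwise disjoint arbitrarily small balls is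
zero-dimensional. -/
theorem isZeroDim_of_pairwiseDisjoint_closedEBall {X : Type*} [EMetricSpace X] {L : Set X}
    {E : ℕ → Set X} {r : ℕ → ℝ≥0∞} (hE : ∀ n, (E n).Finite) (hr : Tendsto r atTop (𝓝 0))
    (hdisj : ∀ n, (E n).PairwiseDisjoint fun x ↦ closedEBall x (r n))
    (hL : ∀ n, L ⊆ ⋃ x ∈ E n, closedEBall x (r n)) : IsZeroDim L := by
  rw [isZeroDim_iff]
  intro p U hp hU
  obtain ⟨ε, hε, hεU⟩ := EMetric.mem_nhds_iff.1 (hU.mem_nhds hp)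
  have hlim : Tendsto (fun n ↦ r n + r n) atTop (𝓝 0) := by simpa using hr.add hr
  obtain ⟨n, hn⟩ := (hlim.eventually (gt_mem_nhds hε)).exists
  obtain ⟨x, hx, hpx⟩ := mem_iUnion₂.1 (hL n p.2)
  have hcl : ∀ y, IsClosed (Subtype.val ⁻¹' closedEBall y (r n) : Set L) := fun y ↦
    isClosed_closedEBall.preimage continuous_subtype_val
  refine ⟨Subtype.val ⁻¹' closedEBall x (r n), ⟨hcl x, ?_⟩, hpx, fun q hq ↦ hεU ?_⟩
  · have : (Subtype.val ⁻¹' closedEBall x (r n) : Set L)ᶜ =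
        ⋃ y ∈ E n \ {x}, Subtype.val ⁻¹' closedEBall y (r n) := by
      ext q
      constructor
      · intro hq
        obtain ⟨y, hy, hqy⟩ := mem_iUnion₂.1 (hL n q.2)
        exact mem_biUnion (show y ∈ E n \ {x} from ⟨hy, by rintro rfl; exact hq hqy⟩) hqy
      · intro hq hqx
        obtain ⟨y, hy, hqy⟩ := mem_iUnion₂.1 hq
        exact disjoint_left.1 (hdisj n hy.1 hx hy.2) hqy hqx
    rw [← isClosed_compl_iff, this]
    exact ((hE n).subset sdiff_subset).isClosed_biUnion fun y _ ↦ hcl y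
  · calc edist (q : X) p ≤ edist (q : X) x + edist x p := edist_triangle _ _ _
      _ ≤ r n + r n := by gcongr; exacts [hq, by rw [edist_comm]; exact hpx]
      _ < ε := hn

/-- If the family of closed zero-dimensional sets is `F_σ`, then the space is zero-dimensional. -/
theorem isZeroDim_of_isFSigma {X : Type*} [EMetricSpace X] [SecondCountableTopology X]
    (hX : TotallyBounded (univ : Set X))
    (hF : IsFSigma {F : Closeds X | IsZeroDim (F : Set X)}) : IsZeroDim (univ : Set X) := by
  obtain ⟨C, hC, hCeq⟩ := hF
  by_contra hX0
  obtain ⟨Y, hY, ⟨y₀, hy₀⟩, hYV⟩ := exists_nowhere_zeroDim hX0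
  obtain ⟨u, -, hu, hu0⟩ := exists_seq_strictAnti_tendsto' (zero_lt_one (α := ℝ≥0∞))
  -- A condition is a finite subset of `Y` with a positive radius. It promises that the final set
  -- contains the points and lies in the closed balls of that radius about them.
  let P := {q : Set X × ℝ≥0∞ // q.1.Finite ∧ q.1 ⊆ Y ∧ q.1.Nonempty ∧ 0 < q.2}
  have step : ∀ (n : ℕ) (q : P), ∃ q' : P, q.1.1 ⊆ q'.1.1 ∧
      (⋃ x ∈ q'.1.1, closedEBall x q'.1.2) ⊆ (⋃ x ∈ q.1.1, closedEBall x q.1.2) ∧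
      q'.1.2 ≤ u n ∧ q'.1.1.PairwiseDisjoint (fun x ↦ closedEBall x q'.1.2) ∧
      ∀ L : Closeds X, hausdorffEDist (L : Set X) q'.1.1 ≤ q'.1.2 → L ∉ C n := by
    rintro n ⟨⟨E, r⟩, hE, hEY, ⟨e₀, he₀⟩, hr⟩
    -- The slack `ρ < r` keeps the closure `M` inside the open `r`-balls, which leaves room for
    -- small balls about the new points.
    obtain ⟨ρ, hρ0, hρ⟩ := exists_between hr
    let V : Set X := ⋃ x ∈ E, eball x ρ
    have hV : IsOpen V := isOpen_biUnion fun _ _ ↦ isOpen_eball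
    have hEV : E ⊆ V := fun x hx ↦ mem_biUnion hx (mem_eball_self hρ0)
    let M : Closeds X := Closeds.closure (V ∩ Y)
    have hMY : (M : Set X) ⊆ Y := closure_minimal inter_subset_right hY
    have hEM : E ⊆ M := fun x hx ↦ subset_closure ⟨hEV hx, hEY hx⟩
    have hMball : (M : Set X) ⊆ ⋃ x ∈ E, eball x r := by
      have h1 : (M : Set X) ⊆ ⋃ x ∈ E, closedEBall x ρ := closure_minimal
        (inter_subset_left.trans (biUnion_mono subset_rfl fun x _ ↦ eball_subset_closedEBall))
        (hE.isClosed_biUnion fun _ _ ↦ isClosed_closedEBall)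
      exact h1.trans (biUnion_mono subset_rfl fun x _ y hy ↦ lt_of_le_of_lt hy hρ)
    have hMC : M ∉ C n := fun h ↦ hYV V hV ⟨e₀, hEV he₀, hEY he₀⟩
      (hCeq.symm.subset (mem_iUnion.2 ⟨n, h⟩))
    -- Since `M` is not zero-dimensional and `C n` is closed, an `ε`-ball about `M` misses `C n`. A
    -- finite `E'` within `ε / 2` of `M`, with radius below `ε / 2`, then keeps every admissible `L`
    -- out of `C n`.
    obtain ⟨ε, hε0, hε⟩ := EMetric.mem_nhds_iff.1 ((hC n).isOpen_compl.mem_nhds hMC)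
    obtain ⟨δ, hδ0, hδ⟩ := exists_between (ENNReal.half_pos hε0.ne')
    obtain ⟨E₁, hE₁M, hE₁, hME₁⟩ := EMetric.totallyBounded_iff'.1
      (hX.subset (subset_univ (M : Set X))) δ hδ0
    let E' := E ∪ E₁
    have hE' : E'.Finite := hE.union hE₁
    have hE'M : E' ⊆ M := union_subset hEM hE₁M
    have hdist : hausdorffEDist E' M ≤ δ := by
      refine hausdorffEDist_le_of_infEDist (fun x hx ↦ ?_) fun x hx ↦ ?_
      · rw [infEDist_zero_of_mem (hE'M hx)]; exact zero_le
      · obtain ⟨y, hy, hxy⟩ := mem_iUnion₂.1 (hME₁ hx)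
        exact (infEDist_le_edist_of_mem (.inr hy)).trans (le_of_lt hxy)
    have hev1 : ∀ᶠ s in 𝓝[>] (0 : ℝ≥0∞), ∀ x ∈ E', ∃ y ∈ E, edist x y + s < r := by
      rw [eventually_all_finite hE']
      intro x hx
      obtain ⟨y, hy, hxy⟩ := mem_iUnion₂.1 (hMball (hE'M hx))
      have hlim : Tendsto (fun s : ℝ≥0∞ ↦ edist x y + s) (𝓝 0) (𝓝 (edist x y)) := by
        simpa using (tendsto_const_nhds (x := edist x y)).add (tendsto_id (x := 𝓝 (0 : ℝ≥0∞)))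
      filter_upwards [nhdsWithin_le_nhds (hlim.eventually (gt_mem_nhds hxy))] with s hs
      exact ⟨y, hy, hs⟩
    have hev2 : ∀ᶠ s in 𝓝[>] (0 : ℝ≥0∞), ∀ x ∈ E', ∀ y ∈ E', x ≠ y → s + s < edist x y := by
      rw [eventually_all_finite hE']
      intro x hx
      rw [eventually_all_finite hE']
      intro y hy
      by_cases hxy : x = y
      · exact .of_forall fun s h ↦ absurd hxy h
      have hlim : Tendsto (fun s : ℝ≥0∞ ↦ s + s) (𝓝 0) (𝓝 0) := by
        simpa using (tendsto_id (x := 𝓝 (0 : ℝ≥0∞))).add (tendsto_id (x := 𝓝 (0 : ℝ≥0∞)))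
      filter_upwards [nhdsWithin_le_nhds (hlim.eventually (gt_mem_nhds (edist_pos.2 hxy)))]
        with s hs _ using hs
    have hlt : ∀ a : ℝ≥0∞, 0 < a → ∀ᶠ s in 𝓝[>] (0 : ℝ≥0∞), s < a := fun a ha ↦
      nhdsWithin_le_nhds (gt_mem_nhds ha)
    have : (𝓝[>] (0 : ℝ≥0∞)).NeBot := nhdsGT_neBot_of_exists_gt ⟨1, zero_lt_one⟩
    -- Small enough for the new balls to lie in the old ones, to be disjoint, to have radius below
    -- `u n`, and to stay within `ε / 2`.
    obtain ⟨s, hs1, hs2, hs3, hs4, hs5⟩ := (hev1.and (hev2.and ((hlt _ (hu n).1).and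
      ((hlt _ (ENNReal.half_pos hε0.ne')).and self_mem_nhdsWithin)))).exists
    refine ⟨⟨(E', s), hE', hE'M.trans hMY, ⟨e₀, .inl he₀⟩, hs5⟩, subset_union_left, ?_, hs3.le,
      ?_, ?_⟩
    · refine iUnion₂_subset fun x hx z hz ↦ ?_
      obtain ⟨y, hy, hxy⟩ := hs1 x hx
      refine mem_biUnion hy ?_
      calc edist z y ≤ edist x y + edist z x := by
            rw [add_comm]; exact edist_triangle _ _ _
        _ ≤ edist x y + s := by gcongr; exact hz
        _ ≤ r := hxy.le
    · intro x hx y hy hxy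
      refine disjoint_left.2 fun z hzx hzy ↦ (hs2 x hx y hy hxy).not_ge ?_
      calc edist x y ≤ edist x z + edist z y := edist_triangle _ _ _
        _ ≤ s + s := by gcongr; exacts [by rw [edist_comm]; exact hzx, hzy]
    · intro L hL hLC
      refine hε (show edist L M < ε from ?_) hLC
      calc hausdorffEDist (L : Set X) M ≤ hausdorffEDist (L : Set X) E' + hausdorffEDist E' M :=
            hausdorffEDist_triangle
        _ ≤ s + δ := add_le_add hL hdist
        _ < ε / 2 + ε / 2 := ENNReal.add_lt_add hs4 hδ
        _ = ε := ENNReal.add_halves ε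
  choose g hg1 hg2 hg3 hg4 hg5 using step
  let q : ℕ → P := fun n ↦
    Nat.rec ⟨({y₀}, 1), finite_singleton _, by simpa using hy₀, singleton_nonempty _, zero_lt_one⟩
      g n
  let D : ℕ → Set X := fun n ↦ ⋃ x ∈ (q n).1.1, closedEBall x (q n).1.2
  have hDcl : ∀ n, IsClosed (D n) := fun n ↦
    (q n).2.1.isClosed_biUnion fun _ _ ↦ isClosed_closedEBall
  have hD : Antitone D := antitone_nat_of_succ_le fun n ↦ hg2 n (q n)
  have hE : Monotone fun n ↦ (q n).1.1 := monotone_nat_of_le_succ fun n ↦ hg1 n (q n)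
  have hED : ∀ n, (q n).1.1 ⊆ D n := fun n x hx ↦ mem_biUnion hx mem_closedEBall_self
  -- The limit `L` is squeezed between the finite sets and the balls at every stage: disjoint balls
  -- of vanishing radius make it zero-dimensional, and stage `n` excludes it from `C n`.
  let L : Closeds X := Closeds.closure (⋃ n, (q n).1.1)
  have hLD : ∀ n, (L : Set X) ⊆ D n := fun n ↦ closure_minimal (iUnion_subset fun m ↦
    (hE (le_max_left m n)).trans ((hED _).trans (hD (le_max_right m n)))) (hDcl n)
  have hL0 : IsZeroDim (L : Set X) := isZeroDim_of_pairwiseDisjoint_closedEBall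
    (E := fun n ↦ (q (n + 1)).1.1) (r := fun n ↦ (q (n + 1)).1.2) (fun n ↦ (q (n + 1)).2.1)
    (tendsto_of_tendsto_of_tendsto_of_le_of_le tendsto_const_nhds hu0 (fun _ ↦ zero_le)
      fun n ↦ hg3 n (q n)) (fun n ↦ hg4 n (q n)) fun n ↦ hLD (n + 1)
  obtain ⟨n, hn⟩ := mem_iUnion.1 (hCeq.subset hL0)
  refine hg5 n (q n) L (hausdorffEDist_le_of_infEDist (fun x hx ↦ ?_) fun x hx ↦ ?_) hn
  · obtain ⟨y, hy, hxy⟩ := mem_iUnion₂.1 (hLD (n + 1) hx)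
    exact (infEDist_le_edist_of_mem hy).trans hxy
  · rw [infEDist_zero_of_mem (show x ∈ (L : Set X) from
      subset_closure (mem_iUnion.2 ⟨n + 1, hx⟩))]
    exact zero_le

/-! ### Transfer to the admissible topology. -/

/-- A closed set is recovered as the preimage under `e` of the closure of its image. -/
theorem FHyp.injective_toCompacts {X K : Type*} [TopologicalSpace X] [TopologicalSpace K]
    [CompactSpace K] {e : X → K} (he : IsEmbedding e) :
    Function.Injective (FHyp.toCompacts e) := by
  intro F G h
  have h1 : closure (e '' F.carrier) = closure (e '' G.carrier) :=
    congrArg (fun L : Compacts K ↦ (L : Set K)) h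
  have h2 : ∀ H : Closeds X, e ⁻¹' closure (e '' H.carrier) = H.carrier := fun H ↦ by
    rw [← he.isInducing.closure_eq_preimage_closure_image, H.isClosed'.closure_eq]
  exact Closeds.ext ((h2 F).symm.trans ((congrArg (e ⁻¹' ·) h1).trans (h2 G)))

theorem FHyp.isInducing_toCompacts {X K : Type*} [TopologicalSpace X] [TopologicalSpace K]
    [CompactSpace K] (e : X → K) : IsInducing (FHyp.toCompacts e) := ⟨rfl⟩

/-- For an isometric embedding, the admissible topology is that of the Hausdorff edistance. -/
def FHyp.homeomorphCloseds {X K : Type*} [MetricSpace X] [MetricSpace K] [CompactSpace K]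
    {e : X → K} (he : Isometry e) : FHyp e ≃ₜ Closeds X :=
  Equiv.toHomeomorphOfIsInducing (Equiv.refl (Closeds X) : FHyp e ≃ Closeds X) <| by
    let j : Closeds X → Compacts K := FHyp.toCompacts e
    have hj : Isometry j := fun F G ↦ by
      change hausdorffEDist (closure (e '' F)) (closure (e '' G)) = hausdorffEDist (F : Set X) G
      rw [hausdorffEDist_closure, hausdorffEDist_image he]
    exact hj.isUniformInducing.isInducing.of_comp_iff.1 (FHyp.isInducing_toCompacts e)

/-- A parametrization of the image lifts through `j`, and the lift is continuous because `j` is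
inducing. -/
theorem analyticSet_of_image {Y Z : Type*} [TopologicalSpace Y] [TopologicalSpace Z] {j : Y → Z}
    (hj : IsInducing j) (hinj : Function.Injective j) {A : Set Y} (hA : AnalyticSet (j '' A)) :
    AnalyticSet A := by
  rw [AnalyticSet] at hA ⊢
  rcases hA with h | ⟨f, hf, hfA⟩
  · exact .inl (image_eq_empty.1 h)
  have hex : ∀ w, ∃ a ∈ A, j a = f w := fun w ↦ hfA.subset ⟨w, rfl⟩
  choose g hgA hg using hex
  refine .inr ⟨g, hj.continuous_iff.2 (by rwa [show j ∘ g = f from funext hg]), ?_⟩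
  refine subset_antisymm (range_subset_iff.2 hgA) fun a ha ↦ ?_
  obtain ⟨w, hw⟩ := hfA.symm.subset ⟨a, ha, rfl⟩
  exact ⟨w, hinj ((hg w).trans hw)⟩

theorem analyticSet_union {Y : Type*} [TopologicalSpace Y] {A B : Set Y} (hA : AnalyticSet A)
    (hB : AnalyticSet B) : AnalyticSet (A ∪ B) := by
  rw [union_eq_iUnion]
  exact .iUnion (by rintro (_ | _) <;> assumption)

theorem analyticSet_inter {Y : Type*} [TopologicalSpace Y] [T2Space Y] {A B : Set Y}
    (hA : AnalyticSet A) (hB : AnalyticSet B) : AnalyticSet (A ∩ B) := by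
  rw [inter_eq_iInter]
  exact .iInter (by rintro (_ | _) <;> assumption)

theorem isClosed_setOf_mem_compacts {K : Type*} [MetricSpace K] :
    IsClosed {q : K × Compacts K | q.1 ∈ q.2} := by
  have h : {q : K × Compacts K | q.1 ∈ q.2} = {q | infEDist q.1 (q.2.toCloseds : Set K) = 0} := by
    ext ⟨p, L⟩
    simp only [mem_ofPred_eq]
    rw [← mem_closure_iff_infEDist_zero, L.toCloseds.isClosed.closure_eq]
    rfl
  rw [h]
  exact isClosed_eq (Closeds.continuous_infEDist.comp
    (continuous_fst.prodMk (Compacts.continuous_toCloseds.comp continuous_snd))) continuous_const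

/-- The closed subsets of an analytic space form an analytic subset of the hyperspace. -/
theorem IsAnalyticSpace.analyticSet_range_toCompacts {X K : Type*} [TopologicalSpace X]
    [MetricSpace K] [CompactSpace K] {e : X → K} (he : IsEmbedding e) (hX : IsAnalyticSpace X) :
    AnalyticSet (range (FHyp.toCompacts e)) := by
  have hbot : AnalyticSet {(⊥ : Compacts K)} := isClosed_singleton.analyticSet
  have hbot' : FHyp.toCompacts e (⊥ : Closeds X) = ⊥ := by
    refine Compacts.ext ?_
    change closure (e '' ∅) = ∅
    simp
  rw [IsAnalyticSpace, AnalyticSet] at hX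
  rcases hX with hX | ⟨g, hg, hgX⟩
  · have : IsEmpty X := univ_eq_empty_iff.1 hX
    convert hbot
    refine subset_antisymm (range_subset_iff.2 fun F ↦ ?_) (singleton_subset_iff.2 ⟨_, hbot'⟩)
    rw [mem_singleton_iff, ← hbot']
    exact congrArg _ (Closeds.ext (eq_empty_of_isEmpty _ |>.trans (eq_empty_of_isEmpty _).symm))
  have := he.secondCountableTopology
  have hc : Continuous (e ∘ g) := he.continuous.comp hg
  obtain ⟨b, hb, -, hbasis⟩ := exists_countable_basis K
  have := hb.to_subtype
  -- A pair `(L, y)` consists of a compact set and codes for a sequence in `X`. The conditions `S₁`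
  -- and `S₂` say that the coded points lie in `L` and are dense in it; they are Borel, and
  -- projecting gives the closures of nonempty closed sets. The empty set has no code and is added
  -- by hand.
  let Q := Compacts K × (ℕ → ℕ → ℕ)
  let S₁ : ℕ → Set Q := fun n ↦ {q | e (g (q.2 n)) ∈ q.1}
  let S₂ : b → Set Q := fun U ↦
    {q | (q.1 : Set K) ∩ U = ∅} ∪ {q | ∃ n, e (g (q.2 n)) ∈ (U : Set K)}
  have hev : ∀ n, Continuous fun q : Q ↦ e (g (q.2 n)) := fun n ↦
    hc.comp ((continuous_apply n).comp continuous_snd)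
  borelize Q
  have hS₁ : ∀ n, MeasurableSet (S₁ n) := fun n ↦
    (isClosed_setOf_mem_compacts.preimage ((hev n).prodMk continuous_fst)).measurableSet
  have hS₂ : ∀ U, MeasurableSet (S₂ U) := by
    intro U
    have hU : IsOpen (U : Set K) := hbasis.isOpen U.2
    have h1 : IsClosed {q : Q | (q.1 : Set K) ∩ U = ∅} := by
      have : {q : Q | (q.1 : Set K) ∩ U = ∅} =
          Prod.fst ⁻¹' {L : Compacts K | ((L : Set K) ∩ U).Nonempty}ᶜ :=
        Set.ext fun q ↦ not_nonempty_iff_eq_empty.symm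
      rw [this]
      exact (Compacts.isOpen_inter_nonempty_of_isOpen hU).isClosed_compl.preimage continuous_fst
    have h2 : IsOpen {q : Q | ∃ n, e (g (q.2 n)) ∈ (U : Set K)} := by
      simp only [ofPred_exists]
      exact isOpen_iUnion fun n ↦ hU.preimage (hev n)
    exact h1.measurableSet.union h2.measurableSet
  have hS : AnalyticSet (Prod.fst '' ((⋂ n, S₁ n) ∩ ⋂ U, S₂ U)) :=
    ((MeasurableSet.iInter hS₁).inter (MeasurableSet.iInter hS₂)).analyticSet.image_of_continuous
      continuous_fst
  convert analyticSet_union hbot hS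
  apply subset_antisymm
  · rintro _ ⟨F, rfl⟩
    rcases F.carrier.eq_empty_or_nonempty with hF | hF
    · refine .inl ?_
      rw [← hbot']
      exact congrArg _ (Closeds.ext hF)
    refine .inr ?_
    have := hF.to_subtype
    obtain ⟨u, hu⟩ := exists_dense_seq F.carrier
    choose y hy using fun n ↦ hgX.symm.subset (mem_univ (u n : X))
    refine ⟨(FHyp.toCompacts e F, y), ⟨mem_iInter.2 fun n ↦ ?_, mem_iInter.2 ?_⟩, rfl⟩
    · exact subset_closure ⟨u n, (u n).2, by rw [← hy n]⟩
    · intro U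
      by_cases hU : closure (e '' F.carrier) ∩ U = ∅
      · exact .inl hU
      obtain ⟨z, hz, hzU⟩ := nonempty_iff_ne_empty.2 hU
      obtain ⟨_, hxU, x, hx, rfl⟩ := mem_closure_iff.1 hz U (hbasis.isOpen U.2) hzU
      obtain ⟨n, hn⟩ := hu.exists_mem_open (s := (fun x : F.carrier ↦ e x) ⁻¹' U)
        ((hbasis.isOpen U.2).preimage (he.continuous.comp continuous_subtype_val)) ⟨⟨x, hx⟩, hxU⟩
      exact .inr ⟨n, by change e (g (y n)) ∈ _; rw [hy n]; exact hn⟩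
  · rintro L (rfl | ⟨⟨L, y⟩, ⟨h1, h2⟩, rfl⟩)
    · exact ⟨_, hbot'⟩
    refine ⟨Closeds.closure (range (g ∘ y)), Compacts.ext ?_⟩
    change closure (e '' closure (range (g ∘ y))) = L
    rw [closure_image_closure he.continuous]
    refine subset_antisymm (closure_minimal ?_ L.isCompact.isClosed) fun p hp ↦ ?_
    · rintro _ ⟨_, ⟨n, rfl⟩, rfl⟩
      exact mem_iInter.1 h1 n
    · refine hbasis.mem_closure_iff.2 fun U hU hpU ↦ ?_
      rcases mem_iInter.1 h2 ⟨U, hU⟩ with h | ⟨n, hn⟩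
      · exact absurd h (nonempty_iff_ne_empty.1 ⟨p, hp, hpU⟩)
      · exact ⟨_, hn, _, ⟨n, rfl⟩, rfl⟩

/-- The only input from dimension theory to the two dichotomy statements. -/
theorem isSigmaIdeal_isZeroDim {X : Type*} [TopologicalSpace X] [MetrizableSpace X]
    [SecondCountableTopology X] : IsSigmaIdeal {F : Closeds X | IsZeroDim (F : Set X)} :=
  fun F _ hF hG ↦ isZeroDim_of_subset_iUnion (fun n ↦ (F n).isClosed) hF hG

/-- The dichotomy for coanalytic `𝓕₀(X)`, relative to `𝓕(X)`. -/
theorem isGδ_or_isCoanalyticComplete_of_isometry {X K : Type*} [MetricSpace X]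
    [SecondCountableTopology X] [MetricSpace K] [CompactSpace K] {e : X → K} (he : Isometry e)
    (hA : IsCoanalytic (FZero e)) : IsGδ (FZero e) ∨ IsCoanalyticComplete (FZero e) := by
  by_cases hG : IsGδ (FZero e)
  · exact .inl hG
  refine .inr ⟨hA, fun B hB ↦ ?_⟩
  let φ := FHyp.homeomorphCloseds he
  have hZ : φ.symm ⁻¹' FZero e = {F : Closeds X | IsZeroDim (F : Set X)} := rfl
  obtain ⟨f, hf, hfB⟩ := isSigmaIdeal_isZeroDim.isCoanalyticHard (X := X)
    (by
      rw [← hZ, ← preimage_compl, ← φ.image_eq_preimage_symm]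
      exact AnalyticSet.image_of_continuous hA φ.continuous)
    (fun h ↦ hG (h.preimage φ.continuous)) B hB
  exact ⟨φ.symm ∘ f, φ.symm.continuous.comp hf, hfB⟩

theorem isGδ_of_isometry {X K : Type*} [MetricSpace X] [SecondCountableTopology X] [MetricSpace K]
    [CompactSpace K] {e : X → K} (he : Isometry e) (hA : AnalyticSet (FZero e)) :
    IsGδ (FZero e) := by
  let φ := FHyp.homeomorphCloseds he
  have h : AnalyticSet (φ '' FZero e) := hA.image_of_continuous φ.continuous
  rw [φ.image_eq_preimage_symm] at h
  exact (isSigmaIdeal_isZeroDim.isGδ_of_analyticSet (X := X) h).preimage φ.continuous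

theorem isZeroDim_of_isometry {X K : Type*} [MetricSpace X] [SecondCountableTopology X]
    [MetricSpace K] [CompactSpace K] {e : X → K} (he : Isometry e) (hF : IsFSigma (FZero e)) :
    IsZeroDim (univ : Set X) := by
  let φ := FHyp.homeomorphCloseds he
  obtain ⟨C, hC, hCeq⟩ := hF
  refine isZeroDim_of_isFSigma (X := X) ?_ ⟨fun n ↦ φ.symm ⁻¹' C n,
    fun n ↦ (hC n).preimage φ.symm.continuous, ?_⟩
  · rw [← preimage_univ (f := e)]
    exact totallyBounded_preimage he.isUniformInducing isCompact_univ.totallyBounded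
  · rw [← preimage_iUnion, ← hCeq]
    rfl

/-- If the traces of the zero-dimensional closed sets are coanalytic in the hyperspace of compact
sets, then they are coanalytic among the traces of closed sets. -/
theorem isCoanalytic_of_image_toCompacts {X K : Type*} [TopologicalSpace X] [MetricSpace K]
    [CompactSpace K] {e : X → K} (he : IsEmbedding e) (hX : IsAnalyticSpace X) {A : Set (FHyp e)}
    (hA : IsCoanalytic (FHyp.toCompacts e '' A)) : IsCoanalytic A := by
  refine analyticSet_of_image (FHyp.isInducing_toCompacts e) (FHyp.injective_toCompacts he) ?_
  -- The complement inside `𝓕(X)` is the ambient complement cut down to the range, and the range is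
  -- analytic because `X` is.
  have h : FHyp.toCompacts e '' Aᶜ = (FHyp.toCompacts e '' A)ᶜ ∩ range (FHyp.toCompacts e) := by
    rw [image_compl_eq_range_sdiff_image (FHyp.injective_toCompacts he), sdiff_eq, inter_comm]
  rw [h]
  exact analyticSet_inter hA (hX.analyticSet_range_toCompacts he)

end ZeroDimHyperspace


theorem mainTheorem9 {X : Type*} {K : Type*} [TopologicalSpace X]
    [TopologicalSpace K] [CompactSpace K] [MetrizableSpace K]
    (e : X → K) (he : IsEmbedding e) :
    (ZeroDimHyperspace.IsAnalyticSpace X →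
      -- part (a)
      (AnalyticSet (ZeroDimHyperspace.FZero e) → IsGδ (ZeroDimHyperspace.FZero e)) ∧
      -- part (b), coanalyticity relative to the Polish hyperspace of compact subsets of `K`
      (ZeroDimHyperspace.IsCoanalytic
          (ZeroDimHyperspace.FHyp.toCompacts e '' ZeroDimHyperspace.FZero e) →
        IsGδ (ZeroDimHyperspace.FZero e) ∨
        ZeroDimHyperspace.IsCoanalyticComplete
          (ZeroDimHyperspace.FHyp.toCompacts e '' ZeroDimHyperspace.FZero e)) ∧
      -- part (b), coanalyticity relative to the hyperspace of closed subsets of `X`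
      (ZeroDimHyperspace.IsCoanalytic (ZeroDimHyperspace.FZero e) →
        IsGδ (ZeroDimHyperspace.FZero e) ∨
        ZeroDimHyperspace.IsCoanalyticComplete (ZeroDimHyperspace.FZero e))) ∧
    (PolishSpace X →
      ZeroDimHyperspace.IsFSigma (ZeroDimHyperspace.FZero e) →
      ZeroDimHyperspace.IsZeroDim X ∧ ZeroDimHyperspace.FZero e = Set.univ) := by
  let _ : MetricSpace K := metrizableSpaceMetric K
  let _ : MetricSpace X := he.comapMetricSpace
  have hiso : Isometry e := fun _ _ ↦ rfl
  have := he.secondCountableTopology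
  refine ⟨fun hX ↦ ⟨ZeroDimHyperspace.isGδ_of_isometry hiso, fun hA ↦ ?_,
    ZeroDimHyperspace.isGδ_or_isCoanalyticComplete_of_isometry hiso⟩, fun _ hF ↦ ?_⟩
  -- Hardness passes from `𝓕(X)` to the compact hyperspace by composing reductions with the
  -- injection; coanalyticity there is the assumption itself.
  · refine (ZeroDimHyperspace.isGδ_or_isCoanalyticComplete_of_isometry hiso
      (ZeroDimHyperspace.isCoanalytic_of_image_toCompacts he hX hA)).imp_right fun h ↦
        ⟨hA, fun B hB ↦ ?_⟩
    obtain ⟨f, hf, hfB⟩ := h.2 B hB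
    refine ⟨ZeroDimHyperspace.FHyp.toCompacts e ∘ f,
      (ZeroDimHyperspace.FHyp.isInducing_toCompacts e).continuous.comp hf, ?_⟩
    rw [preimage_comp,
      preimage_image_eq _ (ZeroDimHyperspace.FHyp.injective_toCompacts he), hfB]
  · have h0 := ZeroDimHyperspace.isZeroDim_of_isometry hiso hF
    refine ⟨h0.of_isInducing (Homeomorph.Set.univ X).symm.isInducing, eq_univ_of_forall fun F ↦ ?_⟩
    exact h0.of_isInducing (IsEmbedding.inclusion (subset_univ F.carrier)).isInducing
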